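/- Let $N\ge 1$ be an integer, $0<\theta\le 2$, $0<\gamma<\min\{\theta,N\}$ and $p=p_0:=1+\theta/N$; if $0<\theta<2$, assume in addition that $\gamma<\theta(p-1)$. For $t>0$ let $$G(x,t)=(2\pi)^{-N}\int_{\mathbb R^N}e^{i x\cdot\xi}\,e^{-t|\xi|^\theta}\,d\xi$$ be the fundamental solution of $\partial_t v+(-\Delta)^{\theta/2}v=0$ in $\mathbb R^N\times(0,\infty)$. For a nonnegative Radon measure $\mu$ on $\mathbb R^N$ and $0<T<\infty$, a solution in $\mathbb R^N\times[0,T)$ of the Cauchy problem $$\partial_t u+(-\Delta)^{\theta/2}u=|x|^{-\gamma}u^p,\qquad u(0)=\mu,$$ is a nonnegative measurable function $u$ on $\mathbb R^N\times(0,T)$ such that $$\infty>u(x,t)=\int_{\mathbb R^N}G(x-y,t)\,d\mu(y)+\int_0^t\int_{\mathbb R^N}G(x-y,t-s)\,|y|^{-\gamma}u(y,s)^p\,dy\,ds$$ for almost all $(x,t)\in\mathbb R^N\times(0,T)$. Theorem. There exists a constant $C_2>0$, depending only on $N$, $\theta$ and $\gamma$, with the following property. Let $0<T<\infty$, let $\mu$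 be a nonnegative Radon measure on $\mathbb R^N$, let $u$ be a solution of the Cauchy problem in $\mathbb R^N\times[0,T)$, and let $z\in\mathbb R^N$ satisfy $|z|>T^{1/\theta}$. Then $$\mu(B(z,\sigma))\le C_2\,|z|^{\frac{\gamma}{p-1}}\left[\log\left(e+\frac{T^{1/\theta}}{\sigma}\right)\right]^{-\frac N\theta}\qquad\text{for all }0<\sigma<T^{1/\theta},$$ where $B(z,\sigma)=\{y\in\mathbb R^N:|y-z|<\sigma\}$. -/

import Mathlib

open MeasureTheory Set
open scoped ENNReal FourierTransform

noncomputable section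

namespace HardyParabolic

/-- The fundamental solution `G(x, t)`, `t > 0`, of `∂ₜ v + (-Δ)^{θ/2} v = 0` in `ℝ^N × (0, ∞)`:
the inverse Fourier transform of `ξ ↦ exp(-t |2πξ|^θ)`. With Mathlib's normalization of the Fourier
transform, `(-Δ)^{θ/2}` is the multiplier `|2πξ|^θ`, so that
`G(x, t) = ∫ exp(2πi ⟨ξ, x⟩) exp(-t |2πξ|^θ) dξ = (2π)^{-N} ∫ exp(i ⟨ξ, x⟩) exp(-t |ξ|^θ) dξ`.
This number is real, since `exp(-t |2πξ|^θ)` is even in `ξ`; the real part only fixes the type. -/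
def heatKernel (N : ℕ) (θ : ℝ) (x : EuclideanSpace ℝ (Fin N)) (t : ℝ) : ℝ :=
  (𝓕⁻ (fun ξ : EuclideanSpace ℝ (Fin N) =>
    ((Real.exp (-t * (2 * Real.pi * ‖ξ‖) ^ θ) : ℝ) : ℂ)) x).re

/-- `u` is a solution in `ℝ^N × [0, T)` of the Cauchy problem
`∂ₜ u + (-Δ)^{θ/2} u = |x|^{-γ} u^p`, `u(0) = μ`: it is a nonnegative (Lebesgue) measurable function
on `ℝ^N × (0, T)` and, for almost all `(x, t)` there,
`∞ > u(x, t) = ∫ G(x - y, t) dμ(y) + ∫₀ᵗ ∫ G(x - y, t - s) |y|^{-γ} u(y, s)^p dy ds`.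
All integrands are nonnegative, and the integrals take values in `[0, ∞]`. The values of `u` outside
`ℝ^N × (0, T)` play no role. -/
structure IsSolution (N : ℕ) (θ γ p T : ℝ) (μ : Measure (EuclideanSpace ℝ (Fin N)))
    (u : EuclideanSpace ℝ (Fin N) × ℝ → ℝ≥0∞) : Prop where
  aemeasurable : AEMeasurable u (volume.restrict (univ ×ˢ Ioo 0 T))
  integral_eq : ∀ᵐ q : EuclideanSpace ℝ (Fin N) × ℝ ∂(volume.restrict (univ ×ˢ Ioo 0 T)),
    u q < ∞ ∧
    u q = (∫⁻ y, ENNReal.ofReal (heatKernel N θ (q.1 - y) q.2) ∂μ) +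
      ∫⁻ s in Ioo 0 q.2, ∫⁻ y : EuclideanSpace ℝ (Fin N),
        ENNReal.ofReal (heatKernel N θ (q.1 - y) (q.2 - s)) *
          ENNReal.ofReal (‖y‖ ^ (-γ)) * u (y, s) ^ p

/-- The exponent `p₀ = 1 + θ / N`. -/
def fujitaExponent (N : ℕ) (θ : ℝ) : ℝ := 1 + θ / N

end HardyParabolic

end

/-!
Near `z`, within distance of order `T^{1/θ} < |z|`, the weight `|x|^{-γ}` is at least a multiple of
`|z|^{-γ}`, and the problem looks like the Fujita-critical equation
`∂ₜ u + (-Δ)^{θ/2} u = |z|^{-γ} u^p`, `p = 1 + θ/N`. Consider the mass `A(t)` of the solution in the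
ball `B(z, ρ(t))` with `ρ(t)^θ = σ^θ + t`.

The only fact needed about the fundamental solution is `G(x, t) ≥ c t^{-N/θ}` for
`|x| < a t^{1/θ}`, with some small `a` (`exists_heatKernel_lower_bound`). It follows from
self-similarity and from the continuity of `G(·, 1)` and `G(0, 1) > 0`. Consequently a ball of
radius `ρ` retains a fixed fraction `δ` of the heat emitted at any of its points for times up to
`ρ^θ` (`le_lintegral_kernelMinorant`). Integrating the integral equation over `B(z, ρ(t))` gives
`A(t) ≥ δ H(t)`, where `H(t) = μ(B(z, σ)) + ∫₀ᵗ ∫_{B(z, ρ(s))} |y|^{-γ} u^p dy ds`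
(`mass_le_of_supersolution`). By Jensen's inequality and the criticality `N (p - 1) = θ`,
`H'(t) ≥ k |z|^{-γ} H(t)^p / (σ^θ + t)` (`rpow_mass_le_source`).

In the logarithmic time `log (1 + t/σ^θ)` this is `g' ≥ k |z|^{-γ} g^p`, whose solutions blow up
after a time of order `|z|^γ g(0)^{-(p-1)}` (`lifespan_le`, `log_lifespan_le`). But `H` is finite on
`[0, T)`, because `u` is finite almost everywhere (`lintegral_source_lt_top`). Therefore
`μ(B(z, σ))^{p-1} log (1 + T/σ^θ) ≤ C |z|^γ` (`exists_rpow_mass_mul_log_le`), which is the claim,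
since `1/(p-1) = N/θ` and the logarithm is comparable to `log (e + T^{1/θ}/σ)`.
-/

noncomputable section

namespace HardyParabolic

/-! ### The fundamental solution near the origin -/

theorem integrable_exp_neg_rpow_norm (N : ℕ) (hN : 1 ≤ N) {θ : ℝ} (hθ : 0 < θ) :
    Integrable fun ξ : EuclideanSpace ℝ (Fin N) => Real.exp (-(2 * Real.pi * ‖ξ‖) ^ θ) := by
  have : Nonempty (Fin N) := ⟨⟨0, hN⟩⟩
  refine (integrable_fun_norm_addHaar (F := ℝ) volume
    (f := fun r : ℝ => Real.exp (-(2 * Real.pi * r) ^ θ))).2 ?_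
  have h := integrableOn_rpow_mul_exp_neg_mul_rpow (p := θ) (s := ((N - 1 : ℕ) : ℝ))
    (b := (2 * Real.pi) ^ θ) (by have : (0 : ℝ) ≤ ((N - 1 : ℕ) : ℝ) := by positivity
                                 linarith) hθ (by positivity)
  refine h.congr_fun (fun r hr => ?_) measurableSet_Ioi
  have hr : 0 < r := hr
  simp only [finrank_euclideanSpace, Fintype.card_fin, Real.rpow_natCast, smul_eq_mul]
  rw [Real.mul_rpow (by positivity) hr.le, neg_mul]

/-- Self-similarity of the fundamental solution: `G(x, t) = t^{-N/θ} G(t^{-1/θ} x, 1)`. -/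
theorem heatKernel_scaling (N : ℕ) {θ t : ℝ} (hθ : 0 < θ) (ht : 0 < t)
    (x : EuclideanSpace ℝ (Fin N)) :
    heatKernel N θ x t =
      (t ^ (-(1 / θ))) ^ N * heatKernel N θ (t ^ (-(1 / θ)) • x) 1 := by
  set R : ℝ := t ^ (-(1 / θ)) with hR
  have hRpos : 0 < R := by positivity
  have hRt : R ^ θ = t⁻¹ := by
    rw [hR, ← Real.rpow_mul ht.le]
    have : -(1 / θ) * θ = -1 := by field_simp
    rw [this, Real.rpow_neg_one]
  have key := Measure.integral_comp_smul (volume : Measure (EuclideanSpace ℝ (Fin N)))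
    (fun ξ => Complex.exp (↑(2 * Real.pi * inner ℝ ξ x) * Complex.I) •
      ((Real.exp (-t * (2 * Real.pi * ‖ξ‖) ^ θ) : ℝ) : ℂ)) R
  have hcomp : ∀ η : EuclideanSpace ℝ (Fin N),
      (-t * (2 * Real.pi * ‖R • η‖) ^ θ) = -1 * (2 * Real.pi * ‖η‖) ^ θ := by
    intro η
    rw [norm_smul, Real.norm_of_nonneg hRpos.le,
      show 2 * Real.pi * (R * ‖η‖) = R * (2 * Real.pi * ‖η‖) by ring,
      Real.mul_rpow hRpos.le (by positivity), hRt]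
    field_simp
  simp only [hcomp, inner_smul_left, finrank_euclideanSpace, Fintype.card_fin] at key
  simp only [heatKernel, Real.fourierInv_eq', inner_smul_right]
  simp only [RCLike.conj_to_real] at key
  rw [key, abs_of_pos (by positivity), Complex.real_smul, Complex.re_ofReal_mul,
    mul_inv_cancel_left₀ (by positivity)]

theorem continuous_heatKernel_one (N : ℕ) (hN : 1 ≤ N) {θ : ℝ} (hθ : 0 < θ) :
    Continuous fun x : EuclideanSpace ℝ (Fin N) => heatKernel N θ x 1 := by
  have hint : Integrable fun ξ : EuclideanSpace ℝ (Fin N) =>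
      ((Real.exp (-1 * (2 * Real.pi * ‖ξ‖) ^ θ) : ℝ) : ℂ) := by
    simp only [neg_one_mul]
    exact (integrable_exp_neg_rpow_norm N hN hθ).ofReal
  have h : Continuous (𝓕 fun ξ : EuclideanSpace ℝ (Fin N) =>
      ((Real.exp (-1 * (2 * Real.pi * ‖ξ‖) ^ θ) : ℝ) : ℂ)) :=
    VectorFourier.fourierIntegral_continuous Real.continuous_fourierChar
      (by exact continuous_inner) hint
  simp only [heatKernel, Real.fourierInv_eq_fourier_neg]
  exact Complex.continuous_re.comp (h.comp continuous_neg)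

theorem heatKernel_zero_one_pos (N : ℕ) (hN : 1 ≤ N) {θ : ℝ} (hθ : 0 < θ) :
    0 < heatKernel N θ 0 1 := by
  have hint := integrable_exp_neg_rpow_norm N hN hθ
  simp only [heatKernel, Real.fourierInv_eq', inner_zero_right, mul_zero, Complex.ofReal_zero,
    zero_mul, Complex.exp_zero, one_smul, neg_one_mul]
  rw [integral_complex_ofReal, Complex.ofReal_re]
  exact integral_exp_pos hint

/-- The only property of the fundamental solution that the argument uses: on a small parabolic
neighbourhood of the origin it is comparable to `t^{-N/θ}` from below. -/
theorem exists_heatKernel_lower_bound (N : ℕ) (hN : 1 ≤ N) {θ : ℝ} (hθ : 0 < θ) :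
    ∃ a c : ℝ, 0 < a ∧ a ≤ 1 ∧ 0 < c ∧ ∀ t : ℝ, 0 < t → ∀ x : EuclideanSpace ℝ (Fin N),
      ‖x‖ < a * t ^ (1 / θ) → c * (t ^ (-(1 / θ))) ^ N ≤ heatKernel N θ x t := by
  have hpos := heatKernel_zero_one_pos N hN hθ
  have hev := (continuous_heatKernel_one N hN hθ).continuousAt.eventually_const_lt
    (half_lt_self hpos)
  obtain ⟨ε, hε, hball⟩ := Metric.eventually_nhds_iff_ball.1 hev
  refine ⟨min ε 1, heatKernel N θ 0 1 / 2, by positivity, min_le_right _ _, by positivity, ?_⟩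
  intro t ht x hx
  rw [heatKernel_scaling N hθ ht, mul_comm]
  refine mul_le_mul_of_nonneg_left (hball _ ?_).le (by positivity)
  rw [mem_ball_zero_iff, norm_smul, Real.norm_of_nonneg (by positivity)]
  calc t ^ (-(1 / θ)) * ‖x‖ < t ^ (-(1 / θ)) * (min ε 1 * t ^ (1 / θ)) := by gcongr
    _ = min ε 1 := by
      rw [mul_comm, mul_assoc, ← Real.rpow_add ht]; simp
    _ ≤ ε := min_le_left _ _

/-- The truncated lower bound `c t^{-N/θ} 1_{|x| < a t^{1/θ}}` for the fundamental solution. -/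
def kernelMinorant (N : ℕ) (θ a c : ℝ) (x : EuclideanSpace ℝ (Fin N)) (t : ℝ) : ℝ≥0∞ :=
  if ‖x‖ < a * t ^ (1 / θ) then ENNReal.ofReal (c * (t ^ (-(1 / θ))) ^ N) else 0

theorem measurable_kernelMinorant (N : ℕ) (θ a c : ℝ) :
    Measurable fun q : EuclideanSpace ℝ (Fin N) × ℝ => kernelMinorant N θ a c q.1 q.2 := by
  refine Measurable.ite (measurableSet_lt (by fun_prop) (by fun_prop)) (by fun_prop) (by fun_prop)

/-- A ball of radius `ρ` keeps a fixed fraction of the heat emitted at any of its points for a time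
at most `ρ^θ`. -/
theorem le_lintegral_kernelMinorant (N : ℕ) {θ a c : ℝ} (hθ : 0 < θ) (ha : 0 < a) (ha1 : a ≤ 1)
    (hc : 0 < c) {z y : EuclideanSpace ℝ (Fin N)} {ρ τ : ℝ} (hτ : 0 < τ)
    (hτρ : τ ≤ ρ ^ θ) (hy : y ∈ Metric.ball z ρ) :
    ENNReal.ofReal (c * (a / 2) ^ N) * volume (Metric.ball (0 : EuclideanSpace ℝ (Fin N)) 1) ≤
      ∫⁻ x in Metric.ball z ρ, kernelMinorant N θ a c (x - y) τ := by
  have hρ : 0 < ρ := Metric.pos_of_mem_ball hy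
  have hτ' : τ ^ (1 / θ) ≤ ρ := by
    calc τ ^ (1 / θ) ≤ (ρ ^ θ) ^ (1 / θ) := by gcongr
      _ = ρ := by rw [← Real.rpow_mul hρ.le, mul_one_div_cancel hθ.ne', Real.rpow_one]
  set s : ℝ := τ ^ (1 / θ) with hs
  have hs0 : 0 < s := by positivity
  set r : ℝ := a * s with hr
  have hr0 : 0 < r := by positivity
  have hrρ : r ≤ ρ := by nlinarith
  rw [Metric.mem_ball, dist_eq_norm] at hy
  -- the ball of radius `r / 2` touching `y` on the side of `z`
  set w : EuclideanSpace ℝ (Fin N) := y + (r / (2 * ρ)) • (z - y) with hw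
  have hlam : r / (2 * ρ) ≤ 1 := by rw [div_le_one (by positivity)]; linarith
  have hzy : ‖z - y‖ < ρ := by rwa [norm_sub_rev]
  have hwy : ‖w - y‖ < r / 2 := by
    rw [hw, add_sub_cancel_left, norm_smul, Real.norm_of_nonneg (by positivity)]
    calc r / (2 * ρ) * ‖z - y‖ < r / (2 * ρ) * ρ := by gcongr
      _ = r / 2 := by field_simp
  have hwz : ‖w - z‖ ≤ ρ - r / 2 := by
    have : w - z = -((1 - r / (2 * ρ)) • (z - y)) := by rw [hw]; module
    rw [this, norm_neg, norm_smul, Real.norm_of_nonneg (by linarith)]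
    calc (1 - r / (2 * ρ)) * ‖z - y‖ ≤ (1 - r / (2 * ρ)) * ρ := by gcongr
      _ = ρ - r / 2 := by field_simp
  have hsub : Metric.ball w (r / 2) ⊆ Metric.ball z ρ := by
    intro x hx
    rw [Metric.mem_ball, dist_eq_norm] at hx ⊢
    calc ‖x - z‖ ≤ ‖x - w‖ + ‖w - z‖ := norm_sub_le_norm_sub_add_norm_sub _ _ _
      _ < ρ := by linarith
  calc ENNReal.ofReal (c * (a / 2) ^ N) * volume (Metric.ball (0 : EuclideanSpace ℝ (Fin N)) 1)
      = ∫⁻ _ in Metric.ball w (r / 2), ENNReal.ofReal (c * (τ ^ (-(1 / θ))) ^ N) := by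
        rw [setLIntegral_const, Measure.addHaar_ball_of_pos _ w (by positivity), ← mul_assoc,
          ← ENNReal.ofReal_mul (by positivity), finrank_euclideanSpace, Fintype.card_fin,
          mul_assoc c, ← mul_pow]
        have : τ ^ (-(1 / θ)) * (r / 2) = a / 2 := by
          rw [Real.rpow_neg hτ.le, ← hs, hr]; field_simp
        rw [this]
    _ ≤ ∫⁻ x in Metric.ball w (r / 2), kernelMinorant N θ a c (x - y) τ := by
        refine setLIntegral_mono' measurableSet_ball fun x hx => ?_
        rw [Metric.mem_ball, dist_eq_norm] at hx
        rw [kernelMinorant, if_pos]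
        calc ‖x - y‖ ≤ ‖x - w‖ + ‖w - y‖ := norm_sub_le_norm_sub_add_norm_sub _ _ _
          _ < a * τ ^ (1 / θ) := by rw [← hs, ← hr]; linarith
    _ ≤ _ := lintegral_mono_set hsub

/-! ### Blow-up of the integral inequality -/

/-- Discrete form of the blow-up of `g' = k g^p`, `p > 1`: a solution of the corresponding
integral inequality that starts from `m > 0` exists at most for a time of order
`1 / (k m^{p-1})`. -/
theorem lifespan_le {p k m L : ℝ} (hp : 1 < p) (hk : 0 < k) (hm : 0 < m) {g : ℝ → ℝ}
    (h0 : m ≤ g 0)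
    (hg : ∀ a b, 0 ≤ a → a ≤ b → b < L → g a + k * g a ^ p * (b - a) ≤ g b) :
    k * m ^ (p - 1) * L ≤ (1 - 2 ^ (-(p - 1)))⁻¹ := by
  set q : ℝ := 2 ^ (-(p - 1)) with hq
  have hq0 : 0 < q := by positivity
  have hq1 : q < 1 := Real.rpow_lt_one_of_one_lt_of_neg one_lt_two (by linarith)
  have hD : 0 < k * m ^ (p - 1) := by positivity
  by_contra! hcon
  -- `g` doubles on each of the successive intervals of lengths `ℓ q ^ j`
  set ℓ : ℝ := (k * m ^ (p - 1))⁻¹ with hℓ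
  have hℓ0 : 0 < ℓ := by positivity
  have hsum : ∀ j : ℕ, ℓ * ∑ i ∈ Finset.range j, q ^ i ≤ ℓ * (1 - q)⁻¹ := by
    intro j
    gcongr
    rw [← tsum_geometric_of_lt_one hq0.le hq1]
    exact (summable_geometric_of_lt_one hq0.le hq1).sum_le_tsum _ (fun i _ => by positivity)
  have hL : ℓ * (1 - q)⁻¹ < L := by
    rw [hℓ, inv_mul_lt_iff₀ hD]; exact hcon
  have hstep : ∀ j : ℕ, 2 ^ j * m ≤ g (ℓ * ∑ i ∈ Finset.range j, q ^ i) := by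
    intro j
    induction j with
    | zero => simpa using h0
    | succ j ih =>
      have hmono : ∑ i ∈ Finset.range (j + 1), q ^ i =
          (∑ i ∈ Finset.range j, q ^ i) + q ^ j := Finset.sum_range_succ _ _
      have h1 := hg (ℓ * ∑ i ∈ Finset.range j, q ^ i) (ℓ * ∑ i ∈ Finset.range (j + 1), q ^ i)
        (by positivity) (by rw [hmono]; gcongr; linarith [pow_pos hq0 j])
        ((hsum _).trans_lt hL)
      refine le_trans ?_ h1
      have h2 : (2 ^ j * m) ^ p ≤ g (ℓ * ∑ i ∈ Finset.range j, q ^ i) ^ p :=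
        Real.rpow_le_rpow (by positivity) ih (by linarith)
      have h3 : k * (2 ^ j * m) ^ p * (ℓ * q ^ j) = 2 ^ j * m := by
        have e1 : ∀ x : ℝ, 0 < x → x ^ p = x * x ^ (p - 1) := fun x hx => by
          rw [← Real.rpow_one_add' hx.le (by linarith)]; ring_nf
        have e2 : ((2 : ℝ) ^ j) ^ (p - 1) * q ^ j = 1 := by
          rw [hq, ← Real.rpow_natCast, ← Real.rpow_natCast, ← Real.rpow_mul (by norm_num),
            ← Real.rpow_mul (by norm_num), ← Real.rpow_add (by norm_num)]
          ring_nf; simp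
        rw [e1 _ (by positivity), Real.mul_rpow (by positivity) hm.le]
        calc k * (2 ^ j * m * ((2 ^ j) ^ (p - 1) * m ^ (p - 1))) * (ℓ * q ^ j)
            = 2 ^ j * m * (((2 : ℝ) ^ j) ^ (p - 1) * q ^ j) * (k * m ^ (p - 1) * ℓ) := by ring
          _ = 2 ^ j * m := by rw [e2, hℓ, mul_inv_cancel₀ hD.ne']; ring
      calc 2 ^ (j + 1) * m = 2 ^ j * m + k * (2 ^ j * m) ^ p * (ℓ * q ^ j) := by
            rw [h3]; ring
        _ ≤ _ := by
            rw [hmono, mul_add, add_sub_cancel_left]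
            gcongr
  -- monotonicity bounds all these values by a single one
  have hb : ∀ j : ℕ, 2 ^ j * m ≤ g (ℓ * (1 - q)⁻¹) := by
    intro j
    refine (hstep j).trans ?_
    have h1 := hg _ _ (by positivity) (hsum j) hL
    have h4 : 0 ≤ g (ℓ * ∑ i ∈ Finset.range j, q ^ i) := le_trans (by positivity) (hstep j)
    have h5 := mul_nonneg (mul_nonneg hk.le (Real.rpow_nonneg h4 p)) (sub_nonneg.2 (hsum j))
    linarith
  obtain ⟨j, hj⟩ := pow_unbounded_of_one_lt (g (ℓ * (1 - q)⁻¹) / m) one_lt_two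
  rw [div_lt_iff₀ hm] at hj
  exact (hb j).not_gt hj

theorem lintegral_Ioo_div_add {k s₀ t₁ t₂ : ℝ} (hk : 0 < k) (hs₀ : 0 < s₀) (ht₁ : 0 ≤ t₁)
    (ht : t₁ ≤ t₂) :
    ∫⁻ s in Ioo t₁ t₂, ENNReal.ofReal (k / (s₀ + s)) =
      ENNReal.ofReal (k * Real.log ((s₀ + t₂) / (s₀ + t₁))) := by
  have hcont : ContinuousOn (fun s => k / (s₀ + s)) (Icc t₁ t₂) := by
    refine continuousOn_const.div (by fun_prop) fun s hs => ?_
    have : 0 ≤ s := ht₁.trans hs.1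
    positivity
  rw [← ofReal_integral_eq_lintegral_ofReal
    ((hcont.integrableOn_Icc).mono_set Ioo_subset_Icc_self), ← integral_Ioc_eq_integral_Ioo,
    ← intervalIntegral.integral_of_le ht]
  · congr 1
    simp only [div_eq_mul_inv k]
    rw [intervalIntegral.integral_const_mul,
      intervalIntegral.integral_comp_add_left (fun s => s⁻¹),
      integral_inv_of_pos (by positivity) (by linarith)]
  · refine (ae_restrict_iff' measurableSet_Ioo).2 (.of_forall fun s hs => ?_)
    have : 0 < s := ht₁.trans_lt hs.1
    simp only [Pi.zero_apply]
    positivity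

/-- If the finite function `H(t) = m + ∫₀ᵗ Φ` satisfies `H' ≥ k H^p / (s₀ + t)` on `(0, T)`, then
`k m^{p-1} log (1 + T / s₀)` is bounded in terms of `p`. -/
theorem log_lifespan_le {p k m s₀ T : ℝ} (hp : 1 < p) (hk : 0 < k) (hm : 0 < m) (hs₀ : 0 < s₀)
    (hT : 0 < T) {Φ : ℝ → ℝ≥0∞}
    (hfin : ∀ t < T, ∫⁻ s in Ioo 0 t, Φ s < ∞)
    (hΦ : ∀ᵐ t ∂(volume.restrict (Ioo 0 T)),
      ENNReal.ofReal (k / (s₀ + t)) * (ENNReal.ofReal m + ∫⁻ s in Ioo 0 t, Φ s) ^ p ≤ Φ t) :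
    k * m ^ (p - 1) * Real.log (1 + T / s₀) ≤ (1 - 2 ^ (-(p - 1)))⁻¹ := by
  set H : ℝ → ℝ≥0∞ := fun t => ENNReal.ofReal m + ∫⁻ s in Ioo 0 t, Φ s with hH
  have hHfin : ∀ t < T, H t ≠ ∞ := fun t ht =>
    ENNReal.add_ne_top.2 ⟨ENNReal.ofReal_ne_top, (hfin t ht).ne⟩
  have hHmono : Monotone H := fun t₁ t₂ h => by
    simp only [hH]
    gcongr
  have hstep : ∀ t₁ t₂, 0 ≤ t₁ → t₁ ≤ t₂ → t₂ < T →
      H t₁ + ENNReal.ofReal (k * Real.log ((s₀ + t₂) / (s₀ + t₁))) * H t₁ ^ p ≤ H t₂ := by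
    intro t₁ t₂ h0 h12 h2
    have hdisj : Disjoint (Ioo 0 t₁) (Ioo t₁ t₂) :=
      Set.disjoint_left.2 fun s hs hs' => hs.2.not_gt hs'.1
    have hsub : Ioo 0 t₁ ∪ Ioo t₁ t₂ ⊆ Ioo 0 t₂ := by
      rintro s (hs | hs)
      · exact ⟨hs.1, hs.2.trans_le h12⟩
      · exact ⟨h0.trans_lt hs.1, hs.2⟩
    calc H t₁ + ENNReal.ofReal (k * Real.log ((s₀ + t₂) / (s₀ + t₁))) * H t₁ ^ p
        = H t₁ + ∫⁻ s in Ioo t₁ t₂, ENNReal.ofReal (k / (s₀ + s)) * H t₁ ^ p := by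
          rw [lintegral_mul_const _ (by fun_prop), lintegral_Ioo_div_add hk hs₀ h0 h12]
      _ ≤ H t₁ + ∫⁻ s in Ioo t₁ t₂, Φ s := by
          gcongr 1
          refine lintegral_mono_ae ?_
          have hss : Ioo t₁ t₂ ⊆ Ioo 0 T := fun s hs => ⟨h0.trans_lt hs.1, hs.2.trans h2⟩
          filter_upwards [ae_restrict_of_ae_restrict_of_subset hss hΦ,
            ae_restrict_mem measurableSet_Ioo] with s hs hsm
          refine le_trans ?_ hs
          have := hHmono hsm.1.le
          gcongr
      _ ≤ H t₂ := by
          rw [hH, add_assoc, ← lintegral_union measurableSet_Ioo hdisj]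
          exact add_le_add_right (lintegral_mono_set hsub) _
  -- in the logarithmic time `τ = log ((s₀ + t) / s₀)` the inequality becomes autonomous
  have htime : ∀ b, s₀ + s₀ * (Real.exp b - 1) = s₀ * Real.exp b := fun b => by ring
  refine lifespan_le (g := fun τ => (H (s₀ * (Real.exp τ - 1))).toReal) hp hk hm ?_ ?_
  · simp only [Real.exp_zero, sub_self, mul_zero]
    rw [← ENNReal.ofReal_le_iff_le_toReal (hHfin 0 hT)]
    exact le_self_add
  · intro a b ha hab hb
    have hbT : s₀ * (Real.exp b - 1) < T := by
      have h1 : Real.exp b < 1 + T / s₀ := by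
        rwa [← Real.lt_log_iff_exp_lt (by positivity)]
      have h2 : s₀ * (Real.exp b - 1) < s₀ * (T / s₀) := by gcongr; linarith
      rwa [mul_div_cancel₀ _ hs₀.ne'] at h2
    have hab' : s₀ * (Real.exp a - 1) ≤ s₀ * (Real.exp b - 1) := by gcongr
    have ha' : 0 ≤ s₀ * (Real.exp a - 1) :=
      mul_nonneg hs₀.le (by linarith [Real.one_le_exp ha])
    have h := hstep _ _ ha' hab' hbT
    rw [htime, htime, mul_div_mul_left _ _ hs₀.ne', ← Real.exp_sub, Real.log_exp] at h
    have h' := ENNReal.toReal_mono (hHfin _ hbT) h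
    have hafin := hHfin _ (hab'.trans_lt hbT)
    rw [ENNReal.toReal_add hafin (ENNReal.mul_ne_top ENNReal.ofReal_ne_top
      (ENNReal.rpow_ne_top_of_nonneg (by linarith) hafin)), ENNReal.toReal_mul,
      ENNReal.toReal_ofReal (mul_nonneg hk.le (by linarith)), ← ENNReal.toReal_rpow] at h'
    refine le_trans (le_of_eq ?_) h'
    ring

/-- Replaces the logarithm `log (1 + X ^ θ)` of the blow-up argument by `log (e + X)`. -/
theorem log_exp_one_add_le {θ X : ℝ} (hθ : 0 < θ) (hX : 1 ≤ X) :
    Real.log (Real.exp 1 + X) ≤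
      (Real.log (Real.exp 1 + 1) / Real.log 2 + 1 / θ) * Real.log (1 + X ^ θ) := by
  have hl2 : 0 < Real.log 2 := Real.log_pos one_lt_two
  have he := Real.exp_pos 1
  have h1 : Real.log (Real.exp 1 + X) ≤ Real.log (Real.exp 1 + 1) + Real.log X := by
    rw [← Real.log_mul (by positivity) (by positivity)]
    exact Real.log_le_log (by positivity) (by nlinarith)
  have hXθ : 1 ≤ X ^ θ := Real.one_le_rpow hX hθ.le
  have h2 : Real.log 2 ≤ Real.log (1 + X ^ θ) := Real.log_le_log (by norm_num) (by linarith)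
  have h3 : θ * Real.log X ≤ Real.log (1 + X ^ θ) := by
    rw [← Real.log_rpow (by positivity)]
    exact Real.log_le_log (by positivity) (by linarith)
  have h4 : 0 ≤ Real.log (Real.exp 1 + 1) := Real.log_nonneg (by linarith)
  calc Real.log (Real.exp 1 + X)
      ≤ Real.log (Real.exp 1 + 1) / Real.log 2 * Real.log 2 + 1 / θ * (θ * Real.log X) := by
        rw [div_mul_cancel₀ _ hl2.ne', one_div, inv_mul_cancel_left₀ hθ.ne']
        exact h1
    _ ≤ _ := by rw [add_mul]; gcongr

/-! ### Mass of a solution in a ball -/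

/-- At almost every time the integral equation of a solution, with the heat kernel replaced by a
smaller kernel, gives an inequality for a measurable representative of the solution. -/
theorem IsSolution.exists_measurable {N : ℕ} {θ γ p T : ℝ}
    {μ : Measure (EuclideanSpace ℝ (Fin N))} {u : EuclideanSpace ℝ (Fin N) × ℝ → ℝ≥0∞}
    (hu : IsSolution N θ γ p T μ u) {K : EuclideanSpace ℝ (Fin N) → ℝ → ℝ≥0∞}
    (hK : ∀ x t, 0 < t → K x t ≤ ENNReal.ofReal (heatKernel N θ x t)) :
    ∃ v : EuclideanSpace ℝ (Fin N) × ℝ → ℝ≥0∞, Measurable v ∧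
      ∀ᵐ t ∂(volume.restrict (Ioo 0 T)), ∀ᵐ x : EuclideanSpace ℝ (Fin N), v (x, t) < ∞ ∧
        (∫⁻ y, K (x - y) t ∂μ) + ∫⁻ s in Ioo 0 t, ∫⁻ y : EuclideanSpace ℝ (Fin N),
          K (x - y) (t - s) * (ENNReal.ofReal (‖y‖ ^ (-γ)) * v (y, s) ^ p) ≤ v (x, t) := by
  have hvol : (volume : Measure (EuclideanSpace ℝ (Fin N) × ℝ)).restrict (univ ×ˢ Ioo 0 T) =
      (volume : Measure (EuclideanSpace ℝ (Fin N))).prod (volume.restrict (Ioo 0 T)) := by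
    rw [Measure.volume_eq_prod, ← Measure.prod_restrict, Measure.restrict_univ]
  have hslice : ∀ {P : EuclideanSpace ℝ (Fin N) × ℝ → Prop},
      (∀ᵐ q ∂(volume.restrict (univ ×ˢ Ioo 0 T)), P q) →
      ∀ᵐ t ∂(volume.restrict (Ioo 0 T)), ∀ᵐ x : EuclideanSpace ℝ (Fin N), P (x, t) := by
    intro P h
    rw [hvol] at h
    exact Measure.ae_ae_of_ae_prod (p := fun q => P q.swap)
      (Measure.measurePreserving_swap.quasiMeasurePreserving.ae h)
  refine ⟨hu.aemeasurable.mk u, hu.aemeasurable.measurable_mk, ?_⟩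
  have heq := hslice hu.aemeasurable.ae_eq_mk
  have heq' := (ae_restrict_iff' measurableSet_Ioo).1 heq
  filter_upwards [heq, hslice hu.integral_eq, ae_restrict_mem measurableSet_Ioo] with t h1 h2 ht
  filter_upwards [h1, h2] with x hx1 hx2
  rw [← hx1]
  refine ⟨hx2.1, ?_⟩
  rw [hx2.2]
  refine add_le_add (lintegral_mono fun y => hK _ _ ht.1) (lintegral_mono_ae ?_)
  refine (ae_restrict_iff' measurableSet_Ioo).2 ?_
  filter_upwards [heq'] with s hs hst
  refine lintegral_mono_ae ?_
  filter_upwards [hs ⟨hst.1, hst.2.trans ht.2⟩] with y hy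
  rw [hy, mul_assoc]
  gcongr
  exact hK _ _ (sub_pos.2 hst.2)

/-- The mass of `v` in a ball at time `t` controls both the initial mass and the total mass produced
by the source `W` in the ball up to that time. -/
theorem mass_le_of_supersolution {N : ℕ} {θ t ρ : ℝ} {z : EuclideanSpace ℝ (Fin N)}
    {μ : Measure (EuclideanSpace ℝ (Fin N))} [SFinite μ]
    {K : EuclideanSpace ℝ (Fin N) → ℝ → ℝ≥0∞}
    (hK : Measurable fun q : EuclideanSpace ℝ (Fin N) × ℝ => K q.1 q.2) {δ : ℝ≥0∞}
    (hδ : ∀ y ∈ Metric.ball z ρ, ∀ τ, 0 < τ → τ ≤ ρ ^ θ →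
      δ ≤ ∫⁻ x in Metric.ball z ρ, K (x - y) τ)
    {W : EuclideanSpace ℝ (Fin N) × ℝ → ℝ≥0∞} (hW : Measurable W)
    {v : EuclideanSpace ℝ (Fin N) → ℝ≥0∞} (ht : 0 < t) (htρ : t ≤ ρ ^ θ)
    (hv : ∀ᵐ x : EuclideanSpace ℝ (Fin N), (∫⁻ y, K (x - y) t ∂μ) +
      ∫⁻ s in Ioo 0 t, ∫⁻ y : EuclideanSpace ℝ (Fin N), K (x - y) (t - s) * W (y, s) ≤ v x) :
    δ * (μ (Metric.ball z ρ) + ∫⁻ s in Ioo 0 t, ∫⁻ y in Metric.ball z ρ, W (y, s)) ≤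
      ∫⁻ x in Metric.ball z ρ, v x := by
  have hK' : ∀ {α : Type} [MeasurableSpace α] {f : α → EuclideanSpace ℝ (Fin N)} {g : α → ℝ},
      Measurable f → Measurable g → Measurable fun a => K (f a) (g a) := fun hf hg =>
    hK.comp (hf.prodMk hg)
  have hK1 : Measurable fun q : EuclideanSpace ℝ (Fin N) × EuclideanSpace ℝ (Fin N) =>
    K (q.1 - q.2) t := hK' (by fun_prop) (by fun_prop)
  have hK2 : Measurable fun q : (EuclideanSpace ℝ (Fin N) × ℝ) × EuclideanSpace ℝ (Fin N) =>
      K (q.1.1 - q.2) (t - q.1.2) * W (q.2, q.1.2) :=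
    (hK' (by fun_prop) (by fun_prop)).mul (hW.comp (by fun_prop))
  have hWs : ∀ s, Measurable fun y => W (y, s) := fun s => hW.comp measurable_prodMk_right
  have hI2 := hK2.lintegral_prod_right' (ν := (volume : Measure (EuclideanSpace ℝ (Fin N))))
  have hinit : δ * μ (Metric.ball z ρ) ≤
      ∫⁻ x in Metric.ball z ρ, ∫⁻ y, K (x - y) t ∂μ := by
    rw [lintegral_lintegral_swap hK1.aemeasurable, ← setLIntegral_const]
    exact (setLIntegral_mono' measurableSet_ball fun y hy => hδ y hy t ht htρ).trans
      (setLIntegral_le_lintegral _ _)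
  have hsrc : δ * ∫⁻ s in Ioo 0 t, ∫⁻ y in Metric.ball z ρ, W (y, s) ≤
      ∫⁻ x in Metric.ball z ρ, ∫⁻ s in Ioo 0 t, ∫⁻ y : EuclideanSpace ℝ (Fin N),
        K (x - y) (t - s) * W (y, s) := by
    have hswap := lintegral_lintegral_swap (μ := volume.restrict (Metric.ball z ρ))
      (ν := volume.restrict (Ioo 0 t)) (f := fun x s => ∫⁻ y : EuclideanSpace ℝ (Fin N),
        K (x - y) (t - s) * W (y, s)) hI2.aemeasurable
    rw [hswap, ← lintegral_const_mul]
    · refine setLIntegral_mono' measurableSet_Ioo fun s hs => ?_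
      rw [lintegral_lintegral_swap]
      · rw [← lintegral_const_mul _ (hWs s)]
        refine le_trans (setLIntegral_mono' measurableSet_ball fun y hy => ?_)
          (setLIntegral_le_lintegral _ _)
        rw [lintegral_mul_const _ (hK' (by fun_prop) (by fun_prop))]
        gcongr
        exact hδ y hy _ (sub_pos.2 hs.2) (by linarith [hs.1])
      · exact ((hK' (by fun_prop) (by fun_prop)).mul (hW.comp (by fun_prop))).aemeasurable
    · exact (hW.comp measurable_swap).lintegral_prod_right'
  calc _ ≤ ∫⁻ x in Metric.ball z ρ, ((∫⁻ y, K (x - y) t ∂μ) +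
      ∫⁻ s in Ioo 0 t, ∫⁻ y : EuclideanSpace ℝ (Fin N), K (x - y) (t - s) * W (y, s)) := by
        rw [lintegral_add_left hK1.lintegral_prod_right', mul_add]
        exact add_le_add hinit hsrc
    _ ≤ _ := lintegral_mono_ae (ae_restrict_of_ae hv)

/-- Finiteness of a supersolution at almost every point of one time slice makes the source
locally integrable in space up to any earlier time. -/
theorem lintegral_source_lt_top {N : ℕ} {t₀ t₁ r : ℝ} (h01 : t₀ < t₁)
    {K : EuclideanSpace ℝ (Fin N) → ℝ → ℝ≥0∞} {ε : ℝ≥0∞} (hε : ε ≠ 0) (hr : 0 < r)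
    (hK : ∀ x τ, ‖x‖ < r → t₁ - t₀ ≤ τ → τ ≤ t₁ → ε ≤ K x τ)
    {W : EuclideanSpace ℝ (Fin N) × ℝ → ℝ≥0∞} (hW : Measurable W)
    (hfin : ∀ᵐ x : EuclideanSpace ℝ (Fin N), ∫⁻ s in Ioo 0 t₁,
      ∫⁻ y : EuclideanSpace ℝ (Fin N), K (x - y) (t₁ - s) * W (y, s) < ∞)
    {S : Set (EuclideanSpace ℝ (Fin N))} (hS : IsCompact S) :
    ∫⁻ s in Ioo 0 t₀, ∫⁻ y in S, W (y, s) < ∞ := by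
  have hmeas : ∀ S : Set (EuclideanSpace ℝ (Fin N)),
      Measurable fun s => ∫⁻ y in S, W (y, s) := fun S =>
    (hW.comp measurable_swap).lintegral_prod_right'
  have hWs : ∀ s, Measurable fun y => W (y, s) := fun s => hW.comp measurable_prodMk_right
  refine hS.induction_on (p := fun S => ∫⁻ s in Ioo 0 t₀, ∫⁻ y in S, W (y, s) < ∞)
    (by simp) (fun A B hAB hB => ?_) (fun A B hA hB => ?_) (fun x _ => ?_)
  · exact (lintegral_mono fun s => lintegral_mono_set hAB).trans_lt hB
  · refine lt_of_le_of_lt (lintegral_mono fun s => lintegral_union_le _ A B) ?_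
    rw [lintegral_add_left (hmeas A)]
    exact ENNReal.add_lt_top.2 ⟨hA, hB⟩
  · obtain ⟨x', hx', hx'r⟩ := (Measure.dense_of_ae hfin).exists_dist_lt x (half_pos hr)
    refine ⟨Metric.ball x (r / 2), mem_nhdsWithin_of_mem_nhds
      (Metric.ball_mem_nhds _ (half_pos hr)), ?_⟩
    have hle : ε * ∫⁻ s in Ioo 0 t₀, ∫⁻ y in Metric.ball x (r / 2), W (y, s) ≤
        ∫⁻ s in Ioo 0 t₁, ∫⁻ y : EuclideanSpace ℝ (Fin N),
          K (x' - y) (t₁ - s) * W (y, s) := by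
      rw [← lintegral_const_mul _ (hmeas _)]
      refine le_trans (setLIntegral_mono' measurableSet_Ioo fun s hs => ?_)
        (lintegral_mono_set (Ioo_subset_Ioo_right h01.le))
      rw [← lintegral_const_mul _ (hWs s)]
      refine le_trans (setLIntegral_mono' measurableSet_ball fun y hy => ?_)
        (setLIntegral_le_lintegral _ _)
      gcongr
      refine hK _ _ ?_ (by linarith [hs.2]) (by linarith [hs.1])
      rw [← dist_eq_norm]
      calc dist x' y ≤ dist x x' + dist y x := by
            rw [dist_comm x x', dist_comm y x]; exact dist_triangle _ _ _
        _ < r := by linarith [Metric.mem_ball.1 hy]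
    exact ENNReal.lt_top_of_mul_ne_top_right (hle.trans_lt hx').ne hε

/-! ### Lower bound for the source -/

theorem rpow_lintegral_le {α : Type*} [MeasurableSpace α] (ν : Measure α) {p : ℝ} (hp : 1 < p)
    {f : α → ℝ≥0∞} (hf : AEMeasurable f ν) :
    (∫⁻ x, f x ∂ν) ^ p ≤ ν univ ^ (p - 1) * ∫⁻ x, f x ^ p ∂ν := by
  have hpq := Real.HolderConjugate.conjExponent hp
  have h := ENNReal.lintegral_mul_le_Lp_mul_Lq ν hpq hf (aemeasurable_const (b := (1 : ℝ≥0∞)))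
  simp only [Pi.mul_apply, mul_one, ENNReal.one_rpow, lintegral_const, one_mul] at h
  have hp0 : 0 < p := by linarith
  calc (∫⁻ x, f x ∂ν) ^ p
      ≤ ((∫⁻ x, f x ^ p ∂ν) ^ (1 / p) * ν univ ^ (1 / p.conjExponent)) ^ p := by gcongr
    _ = ν univ ^ (p - 1) * ∫⁻ x, f x ^ p ∂ν := by
      rw [ENNReal.mul_rpow_of_nonneg _ _ hp0.le, ← ENNReal.rpow_mul, ← ENNReal.rpow_mul,
        one_div_mul_cancel hp0.ne', ENNReal.rpow_one, mul_comm]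
      congr 2
      rw [Real.conjExponent]
      field_simp

/-- Away from the singularity of the potential, Jensen's inequality bounds the source in a ball from
below by a power of the mass. For `p = 1 + θ/N` the power of the radius is exactly `θ`. -/
theorem rpow_mass_le_source {N : ℕ} (hN : 1 ≤ N) {θ γ p ρ R : ℝ} (hθ : 0 < θ) (hγ : 0 < γ)
    (hp : p = fujitaExponent N θ) (hρ : 0 < ρ) {z : EuclideanSpace ℝ (Fin N)} (hR : ‖z‖ + ρ ≤ R)
    {v : EuclideanSpace ℝ (Fin N) → ℝ≥0∞} (hv : Measurable v) :
    ENNReal.ofReal (R ^ (-γ) * volume.real (Metric.ball (0 : EuclideanSpace ℝ (Fin N)) 1) ^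
        (-(p - 1)) / ρ ^ θ) * (∫⁻ y in Metric.ball z ρ, v y) ^ p ≤
      ∫⁻ y in Metric.ball z ρ, ENNReal.ofReal (‖y‖ ^ (-γ)) * v y ^ p := by
  have : Nonempty (Fin N) := ⟨⟨0, hN⟩⟩
  have hN0 : (0 : ℝ) < N := by exact_mod_cast hN
  have hp1 : p - 1 = θ / N := by rw [hp, fujitaExponent]; ring
  have hpgt : 1 < p := by have : 0 < θ / N := by positivity
                          linarith
  set D := volume.real (Metric.ball (0 : EuclideanSpace ℝ (Fin N)) 1) with hD
  have hDtop : volume (Metric.ball (0 : EuclideanSpace ℝ (Fin N)) 1) ≠ ∞ := measure_ball_lt_top.ne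
  have hD0 : 0 < D := ENNReal.toReal_pos (Metric.measure_ball_pos _ _ one_pos).ne' hDtop
  have hR0 : 0 < R := by linarith [norm_nonneg z]
  have hvolB : volume (Metric.ball z ρ) = ENNReal.ofReal (ρ ^ N * D) := by
    rw [Measure.addHaar_ball_of_pos _ _ hρ, finrank_euclideanSpace, Fintype.card_fin,
      ENNReal.ofReal_mul (by positivity), hD, Measure.real, ENNReal.ofReal_toReal hDtop]
  have hJ := rpow_lintegral_le (volume.restrict (Metric.ball z ρ)) hpgt hv.aemeasurable
  rw [Measure.restrict_apply_univ, hvolB, ENNReal.ofReal_rpow_of_pos (by positivity)] at hJ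
  have hconst : R ^ (-γ) * D ^ (-(p - 1)) / ρ ^ θ * (ρ ^ N * D) ^ (p - 1) = R ^ (-γ) := by
    have h1 : (ρ ^ N) ^ (p - 1) = ρ ^ θ := by
      rw [← Real.rpow_natCast, ← Real.rpow_mul hρ.le, hp1, mul_div_cancel₀ _ hN0.ne']
    rw [Real.mul_rpow (by positivity) hD0.le, h1, Real.rpow_neg hD0.le]
    have : D ^ (p - 1) ≠ 0 := by positivity
    have : ρ ^ θ ≠ 0 := by positivity
    field_simp
  calc _ ≤ ENNReal.ofReal (R ^ (-γ) * D ^ (-(p - 1)) / ρ ^ θ) *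
        (ENNReal.ofReal ((ρ ^ N * D) ^ (p - 1)) * ∫⁻ y in Metric.ball z ρ, v y ^ p) := by gcongr
    _ = ∫⁻ y in Metric.ball z ρ, ENNReal.ofReal (R ^ (-γ)) * v y ^ p := by
      rw [← mul_assoc, ← ENNReal.ofReal_mul (by positivity), hconst,
        lintegral_const_mul _ (by fun_prop)]
    _ ≤ _ := by
      refine lintegral_mono_ae ?_
      -- at the origin the weight has the junk value `0 ^ (-γ) = 0`
      filter_upwards [ae_restrict_mem measurableSet_ball,
        ae_restrict_of_ae (Measure.ae_ne volume (0 : EuclideanSpace ℝ (Fin N)))] with y hy hy0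
      have hy0' : 0 < ‖y‖ := norm_pos_iff.2 hy0
      rw [Metric.mem_ball, dist_eq_norm] at hy
      have hyR : ‖y‖ ≤ R := by
        linarith [norm_le_norm_add_norm_sub z y, norm_sub_rev y z]
      have := Real.rpow_le_rpow_of_nonpos hy0' hyR (neg_nonpos.2 hγ.le)
      gcongr

/-! ### The estimate of the initial mass -/

/-- The bound in its natural form, with the lifespan of the mass in logarithmic time. -/
theorem exists_rpow_mass_mul_log_le {N : ℕ} (hN : 1 ≤ N) {θ γ p : ℝ} (hθ : 0 < θ) (hγ : 0 < γ)
    (hp : p = fujitaExponent N θ) :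
    ∃ C : ℝ, 0 < C ∧ ∀ (μ : Measure (EuclideanSpace ℝ (Fin N))) [IsLocallyFiniteMeasure μ]
      (T : ℝ) (_ : 0 < T) (u : EuclideanSpace ℝ (Fin N) × ℝ → ℝ≥0∞)
      (_ : IsSolution N θ γ p T μ u)
      (z : EuclideanSpace ℝ (Fin N)) (_ : T ^ (1 / θ) < ‖z‖)
      (σ : ℝ) (_ : 0 < σ) (_ : σ < T ^ (1 / θ)),
      μ.real (Metric.ball z σ) ^ (p - 1) * Real.log (1 + T / σ ^ θ) ≤ C * ‖z‖ ^ γ := by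
  obtain ⟨a, c, ha, ha1, hc, hker⟩ := exists_heatKernel_lower_bound N hN hθ
  have hN0 : (0 : ℝ) < N := by exact_mod_cast hN
  have hp1 : p - 1 = θ / N := by rw [hp, fujitaExponent]; ring
  have hp0 : 0 < p - 1 := by rw [hp1]; positivity
  have hpgt : 1 < p := by linarith
  set D := volume.real (Metric.ball (0 : EuclideanSpace ℝ (Fin N)) 1) with hD
  have hDtop : volume (Metric.ball (0 : EuclideanSpace ℝ (Fin N)) 1) ≠ ∞ := measure_ball_lt_top.ne
  have hD0 : 0 < D := ENNReal.toReal_pos (Metric.measure_ball_pos _ _ one_pos).ne' hDtop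
  set δ : ℝ := c * (a / 2) ^ N * D with hδ
  have hδ0 : 0 < δ := by positivity
  have hδE : ENNReal.ofReal δ = ENNReal.ofReal (c * (a / 2) ^ N) *
      volume (Metric.ball (0 : EuclideanSpace ℝ (Fin N)) 1) := by
    rw [hδ, ENNReal.ofReal_mul (by positivity), hD, Measure.real, ENNReal.ofReal_toReal hDtop]
  set q : ℝ := 2 ^ (-(p - 1)) with hq
  have hq1 : q < 1 := Real.rpow_lt_one_of_one_lt_of_neg one_lt_two (by linarith)
  have hq1' : 0 < 1 - q := by linarith
  set B : ℝ := 1 + 2 ^ (1 / θ) with hB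
  have hB0 : 0 < B := by positivity
  set k₀ : ℝ := B ^ (-γ) * D ^ (-(p - 1)) * δ ^ p with hk₀
  have hk₀0 : 0 < k₀ := by positivity
  refine ⟨(1 - q)⁻¹ / k₀, by positivity, ?_⟩
  intro μ _ T hT u hu z hz σ hσ hσT
  have hz0 : 0 < ‖z‖ := (by positivity : (0 : ℝ) < T ^ (1 / θ)).trans hz
  set M := μ.real (Metric.ball z σ) with hM
  have hMtop : μ (Metric.ball z σ) ≠ ∞ := measure_ball_lt_top.ne
  rcases (measureReal_nonneg : 0 ≤ M).eq_or_lt with hM0 | hM0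
  · rw [hM, ← hM0, Real.zero_rpow hp0.ne', zero_mul]
    positivity
  have hME : ENNReal.ofReal M = μ (Metric.ball z σ) := by
    rw [hM, Measure.real, ENNReal.ofReal_toReal hMtop]
  set K := kernelMinorant N θ a c with hK
  have hKle : ∀ x t, 0 < t → K x t ≤ ENNReal.ofReal (heatKernel N θ x t) := by
    intro x t ht
    rw [hK, kernelMinorant]
    split_ifs with h
    · exact ENNReal.ofReal_le_ofReal (hker t ht x h)
    · exact zero_le
  obtain ⟨v, hv, hvae⟩ := hu.exists_measurable hKle
  set W : EuclideanSpace ℝ (Fin N) × ℝ → ℝ≥0∞ :=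
    fun q => ENNReal.ofReal (‖q.1‖ ^ (-γ)) * v q ^ p with hW
  have hWm : Measurable W := by fun_prop
  -- radii of the growing balls: `ρ(s) ^ θ = σ ^ θ + s`
  set s₀ : ℝ := σ ^ θ with hs₀
  have hs₀0 : 0 < s₀ := by positivity
  set ρ : ℝ → ℝ := fun s => (s₀ + s) ^ (1 / θ) with hρ
  have hρθ : ∀ s, 0 ≤ s → ρ s ^ θ = s₀ + s := fun s hs => by
    rw [hρ]
    simp only
    rw [← Real.rpow_mul (by positivity), one_div_mul_cancel hθ.ne', Real.rpow_one]
  have hρ0 : ∀ s, 0 ≤ s → 0 < ρ s := fun s hs => by positivity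
  have hσρ : ∀ s, 0 ≤ s → σ ≤ ρ s := fun s hs => by
    calc σ = s₀ ^ (1 / θ) := by
          rw [hs₀, ← Real.rpow_mul hσ.le, mul_one_div_cancel hθ.ne', Real.rpow_one]
      _ ≤ ρ s := by
          simp only [hρ]
          gcongr
          linarith
  have hρmono : ∀ s t, 0 ≤ s → s ≤ t → ρ s ≤ ρ t := fun s t hs hst => by
    simp only [hρ]
    gcongr
  have hs₀T : s₀ < T := by
    calc s₀ < (T ^ (1 / θ)) ^ θ := by rw [hs₀]; gcongr
      _ = T := by rw [← Real.rpow_mul hT.le, one_div_mul_cancel hθ.ne', Real.rpow_one]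
  have hρz : ∀ s, 0 ≤ s → s ≤ T → ‖z‖ + ρ s ≤ B * ‖z‖ := fun s hs hsT => by
    have h1 : ρ s ≤ 2 ^ (1 / θ) * T ^ (1 / θ) := by
      rw [← Real.mul_rpow (by norm_num) hT.le]
      simp only [hρ]
      gcongr
      linarith
    have h2 : (2 : ℝ) ^ (1 / θ) * T ^ (1 / θ) ≤ 2 ^ (1 / θ) * ‖z‖ := by gcongr
    rw [hB, add_mul, one_mul]
    linarith
  set Φ : ℝ → ℝ≥0∞ := fun s => ∫⁻ y in Metric.ball z (ρ s), W (y, s) with hΦ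
  have hfin : ∀ t < T, ∫⁻ s in Ioo 0 t, Φ s < ∞ := by
    intro t ht
    rcases le_or_gt t 0 with ht0 | ht0
    · simp [Ioo_eq_empty ht0.not_gt]
    -- a time between `t` and `T` at which the solution is finite almost everywhere
    obtain ⟨t₁, ht₁, hbound⟩ : ∃ t₁, t₁ ∈ Ioo t T ∧ ∀ᵐ x : EuclideanSpace ℝ (Fin N),
        ∫⁻ s in Ioo 0 t₁, ∫⁻ y : EuclideanSpace ℝ (Fin N),
          K (x - y) (t₁ - s) * W (y, s) < ∞ := by
      have hne : Filter.NeBot (ae (volume.restrict (Ioo t T))) := by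
        rw [ae_neBot, Ne, Measure.restrict_eq_zero, Real.volume_Ioo]
        simpa using ht
      have hss : Ioo t T ⊆ Ioo 0 T := Ioo_subset_Ioo_left ht0.le
      obtain ⟨t₁, h1, h2⟩ := ((ae_restrict_of_ae_restrict_of_subset hss hvae).and
        (ae_restrict_mem measurableSet_Ioo)).exists
      refine ⟨t₁, h2, ?_⟩
      filter_upwards [h1] with x hx
      exact (le_add_self.trans hx.2).trans_lt hx.1
    have hd : 0 < t₁ - t := sub_pos.2 ht₁.1
    have ht₁0 : 0 < t₁ := ht0.trans ht₁.1
    refine lt_of_le_of_lt (setLIntegral_mono' measurableSet_Ioo fun s hs =>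
      lintegral_mono_set (t := Metric.closedBall z (ρ t))
        ((Metric.ball_subset_ball (hρmono s t hs.1.le hs.2.le)).trans Metric.ball_subset_closedBall))
      (lintegral_source_lt_top ht₁.1 (K := K) (r := a * (t₁ - t) ^ (1 / θ))
        (ε := ENNReal.ofReal (c * (t₁ ^ (-(1 / θ))) ^ N)) ?_ (by positivity) ?_ hWm hbound
        (isCompact_closedBall z (ρ t)))
    · exact (ENNReal.ofReal_pos.2 (by positivity)).ne'
    · intro x τ hx hτ hτ'
      have hτ0 : 0 < τ := hd.trans_le hτ
      rw [hK, kernelMinorant, if_pos (hx.trans_le (by gcongr))]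
      have : t₁ ^ (-(1 / θ)) ≤ τ ^ (-(1 / θ)) :=
        Real.rpow_le_rpow_of_nonpos hτ0 hτ' (by rw [neg_nonpos]; positivity)
      gcongr
  have hmass : ∀ᵐ t ∂(volume.restrict (Ioo 0 T)),
      ENNReal.ofReal (k₀ * ‖z‖ ^ (-γ) / (s₀ + t)) *
        (ENNReal.ofReal M + ∫⁻ s in Ioo 0 t, Φ s) ^ p ≤ Φ t := by
    filter_upwards [hvae, ae_restrict_mem measurableSet_Ioo] with t hvt ht
    have h1 := mass_le_of_supersolution (measurable_kernelMinorant N θ a c)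
      (δ := ENNReal.ofReal δ) (z := z) (ρ := ρ t) (θ := θ) (μ := μ)
      (fun y hy τ hτ hτρ => by
        rw [hδE]
        exact le_lintegral_kernelMinorant N hθ ha ha1 hc hτ hτρ hy) hWm ht.1
      (by rw [hρθ t ht.1.le]; linarith) (hvt.mono fun x hx => hx.2)
    have h2 : ENNReal.ofReal M + ∫⁻ s in Ioo 0 t, Φ s ≤
        μ (Metric.ball z (ρ t)) + ∫⁻ s in Ioo 0 t, ∫⁻ y in Metric.ball z (ρ t), W (y, s) := by
      rw [hME]
      refine add_le_add (measure_mono (Metric.ball_subset_ball (hσρ t ht.1.le)))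
        (setLIntegral_mono' measurableSet_Ioo fun s hs => lintegral_mono_set
          (Metric.ball_subset_ball (hρmono s t hs.1.le hs.2.le)))
    have h3 := rpow_mass_le_source hN hθ hγ hp (hρ0 t ht.1.le) (hρz t ht.1.le ht.2.le)
      (hv.comp (measurable_prodMk_right (y := t)))
    refine le_trans ?_ h3
    rw [hρθ t ht.1.le, ← hD]
    calc ENNReal.ofReal (k₀ * ‖z‖ ^ (-γ) / (s₀ + t)) *
          (ENNReal.ofReal M + ∫⁻ s in Ioo 0 t, Φ s) ^ p
        = ENNReal.ofReal ((B * ‖z‖) ^ (-γ) * D ^ (-(p - 1)) / (s₀ + t)) *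
          (ENNReal.ofReal δ * (ENNReal.ofReal M + ∫⁻ s in Ioo 0 t, Φ s)) ^ p := by
          have ht0 := ht.1
          rw [ENNReal.mul_rpow_of_nonneg _ _ (by linarith : 0 ≤ p),
            ENNReal.ofReal_rpow_of_pos hδ0, ← mul_assoc, ← ENNReal.ofReal_mul (by positivity),
            Real.mul_rpow hB0.le hz0.le, hk₀]
          congr 2
          ring
      _ ≤ _ := by
          gcongr
          exact (mul_le_mul_right h2 _).trans h1
  have hfinal := log_lifespan_le hpgt (by positivity) hM0 hs₀0 hT hfin hmass
  rw [← hq, Real.rpow_neg hz0.le] at hfinal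
  have hzγ : 0 < ‖z‖ ^ γ := by positivity
  rw [div_mul_eq_mul_div, le_div_iff₀ hk₀0]
  calc M ^ (p - 1) * Real.log (1 + T / s₀) * k₀
      = k₀ * (‖z‖ ^ γ)⁻¹ * M ^ (p - 1) * Real.log (1 + T / s₀) * ‖z‖ ^ γ := by
        field_simp
    _ ≤ (1 - q)⁻¹ * ‖z‖ ^ γ := by gcongr

end HardyParabolic

end

theorem theorem1p2 (N : ℕ) (hN : 1 ≤ N) (θ γ p : ℝ) (hθ : 0 < θ) (hθ2 : θ ≤ 2)
    (hγ : 0 < γ) (hγ_lt : γ < min θ (N : ℝ))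
    (hp : p = HardyParabolic.fujitaExponent N θ)
    (hγp : θ < 2 → γ < θ * (p - 1)) :
    ∃ C : ℝ, 0 < C ∧
      ∀ (μ : Measure (EuclideanSpace ℝ (Fin N))) [IsLocallyFiniteMeasure μ]
        (T : ℝ) (_ : 0 < T) (u : EuclideanSpace ℝ (Fin N) × ℝ → ℝ≥0∞)
        (_ : HardyParabolic.IsSolution N θ γ p T μ u)
        (z : EuclideanSpace ℝ (Fin N)) (_ : T ^ (1 / θ) < ‖z‖)
        (σ : ℝ) (_ : 0 < σ) (_ : σ < T ^ (1 / θ)),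
        μ (Metric.ball z σ) ≤
          ENNReal.ofReal (C * ‖z‖ ^ (γ / (p - 1)) *
            Real.log (Real.exp 1 + T ^ (1 / θ) / σ) ^ (-((N : ℝ) / θ))) := by
  obtain ⟨C, hC, hbound⟩ := HardyParabolic.exists_rpow_mass_mul_log_le hN hθ hγ hp
  have hN0 : (0 : ℝ) < N := by exact_mod_cast hN
  have hp1 : p - 1 = θ / N := by rw [hp, HardyParabolic.fujitaExponent]; ring
  have hp0 : 0 < p - 1 := by rw [hp1]; positivity
  set A : ℝ := Real.log (Real.exp 1 + 1) / Real.log 2 + 1 / θ with hA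
  have hA0 : 0 < A := by
    have h1 : 0 < Real.log 2 := Real.log_pos one_lt_two
    have h2 : 0 ≤ Real.log (Real.exp 1 + 1) := Real.log_nonneg (by linarith [Real.exp_pos 1])
    positivity
  refine ⟨(C * A) ^ ((N : ℝ) / θ), by positivity, ?_⟩
  intro μ _ T hT u hu z hz σ hσ hσT
  have hT0 : 0 < T ^ (1 / θ) := by positivity
  have hz0 : 0 < ‖z‖ := hT0.trans hz
  have h := hbound μ T hT u hu z hz σ hσ hσT
  have hX : 1 ≤ T ^ (1 / θ) / σ := (one_le_div hσ).2 hσT.le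
  have hlog := HardyParabolic.log_exp_one_add_le hθ hX
  rw [Real.div_rpow hT0.le hσ.le, ← Real.rpow_mul hT.le, one_div_mul_cancel hθ.ne',
    Real.rpow_one, ← hA] at hlog
  set ℒ : ℝ := Real.log (Real.exp 1 + T ^ (1 / θ) / σ) with hℒ
  have hℒ0 : 0 < ℒ := Real.log_pos (by linarith [Real.exp_pos 1])
  set M := μ.real (Metric.ball z σ) with hM
  have hM0 : 0 ≤ M := measureReal_nonneg
  have hMtop : μ (Metric.ball z σ) ≠ ∞ := measure_ball_lt_top.ne
  rw [← ENNReal.ofReal_toReal hMtop]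
  refine ENNReal.ofReal_le_ofReal ?_
  have h1 : M ^ (p - 1) ≤ C * A * ‖z‖ ^ γ * ℒ⁻¹ := by
    rw [← div_eq_mul_inv, le_div_iff₀ hℒ0]
    calc M ^ (p - 1) * ℒ ≤ M ^ (p - 1) * (A * Real.log (1 + T / σ ^ θ)) := by gcongr
      _ = A * (M ^ (p - 1) * Real.log (1 + T / σ ^ θ)) := by ring
      _ ≤ A * (C * ‖z‖ ^ γ) := by gcongr
      _ = C * A * ‖z‖ ^ γ := by ring
  have hinv : (N : ℝ) / θ = (p - 1)⁻¹ := by rw [hp1, inv_div]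
  calc M = (M ^ (p - 1)) ^ ((N : ℝ) / θ) := by
        rw [hinv, Real.rpow_rpow_inv hM0 hp0.ne']
    _ ≤ (C * A * ‖z‖ ^ γ * ℒ⁻¹) ^ ((N : ℝ) / θ) := by gcongr
    _ = _ := by
        rw [Real.mul_rpow (by positivity) (by positivity),
          Real.mul_rpow (by positivity) (by positivity), ← Real.rpow_mul hz0.le,
          Real.inv_rpow hℒ0.le, ← Real.rpow_neg hℒ0.le, hinv, ← div_eq_mul_inv γ]
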